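/- Consider the regular triangular grid of side length $1$ in the Euclidean plane. A \emph{$\mathcal{TR}$-class} $\mathcal{B}$ is a finite (possibly empty, not necessarily connected) set of faces with pairwise disjoint interiors, each face being a triangle or a quadrangle with unit sides, inner angles in $\{\frac{\pi}{3},\frac{2\pi}{3}\}$ and corners in the grid, subject to the degree condition below. Let $G$ be the plane graph formed by the vertices and edges of the faces of $\mathcal{B}$. A vertex of $G$ is an \emph{inner vertex} if all faces of $G$ around it belong to $\mathcal{B}$, and an \emph{outer vertex} otherwise; it is required that each inner vertex has degree $5$ in $G$ and each outer vertex has degree at most $5$ in $G$. Define: - $\sigma$ is the sum of $\frac{10-3a}{a}$ over all pairs consisting of a face of $\mathcal{B}$ and a corner of that face, where $a\in\{3,4\}$ is the number of corners of the face (so each triangle contributes $1$ and each quadrangle contributes $-2$); - $k$ is the number of outer edges, i.e. of edges of $G$ that lie in exactly one face of $\mathcal{B}$; - $\tau=\sum_{v}(5-\delta(v))$ is the number of free valencies, where $v$ runs over the vertices of $G$ and $\delta(v)$ is the degree of $v$ in $G$; - $b_1$ is the number of vertices $v$ of special type, i.e. those for which the following graph is not connected: its vertices are the faces of $\mathcal{B}$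 that contain $v$ as a corner, and two of them are adjacent if they have a common edge; - $b_2$ is the number of inner angles $\frac{2\pi}{3}$ of faces of $\mathcal{B}$ whose apex is an outer vertex. Then every $\mathcal{TR}$-class $\mathcal{B}$ satisfies \[ \sigma-k+\frac{\tau-k}{3}+\frac{5}{3}b_1+\frac{5}{3}b_2=0 . \] -/

import Mathlib

namespace TriGrid

/-- The vertices of the regular triangular grid: `(a, b)` stands for the point `a + b * exp (iπ/3)`. -/
abbrev Pt : Type := ℤ × ℤ

/-- The position of a grid vertex in the Euclidean plane (grid of side length one). -/
noncomputable def pos (p : Pt) : ℂ := ⟨p.1 + p.2 / 2, Real.sqrt 3 / 2 * p.2⟩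

/-- The six unit directions of the grid in counterclockwise order (`n` is read modulo `6`);
`dir n` points in direction `exp (i n π/3)`. -/
def dir (n : ℕ) : Pt :=
  (![(1, 0), (0, 1), (-1, 1), (-1, 0), (0, -1), (1, -1)] : Fin 6 → Pt) (Fin.ofNat 6 n)

/-- The unit grid triangle (as its set of corners) lying at `p` between the directions
`dir n` and `dir (n + 1)`. -/
def cell (p : Pt) (n : ℕ) : Finset Pt := {p, p + dir n, p + dir (n + 1)}

/-- The faces: unit triangles, and unit quadrangles with inner angles `π/3` and `2π/3`, with
corners in the grid. A unit triangle has one of two orientations, a unit quadrangle one of three.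
`triangle p i` has corners `p`, `p + dir i`, `p + dir (i + 1)`;
`quadrangle p i` has corners `p`, `p + dir i`, `p + dir i + dir (i + 1)`, `p + dir (i + 1)`. -/
inductive Face : Type where
  | triangle (p : Pt) (i : Fin 2) : Face
  | quadrangle (p : Pt) (i : Fin 3) : Face
  deriving DecidableEq

namespace Face

/-- The number of corners of a face. -/
def size : Face → ℕ
  | triangle _ _ => 3
  | quadrangle _ _ => 4

/-- The corners of a face in cyclic (counterclockwise) order; the index is read modulo the
number of corners. -/
def corner : Face → ℕ → Pt
  | triangle p i, j => (![p, p + dir i.val, p + dir (i.val + 1)] : Fin 3 → Pt) (Fin.ofNat 3 j)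
  | quadrangle p i, j =>
      (![p, p + dir i.val, p + dir i.val + dir (i.val + 1), p + dir (i.val + 1)] : Fin 4 → Pt) (Fin.ofNat 4 j)

/-- The set of corners of a face. -/
def verts (f : Face) : Finset Pt := (Finset.range f.size).image f.corner

/-- The set of sides of a face. -/
def edges (f : Face) : Finset (Sym2 Pt) :=
  (Finset.range f.size).image fun j => s(f.corner j, f.corner (j + 1))

/-- The unit grid triangles that make up the region of a face: a quadrangle consists of the two
triangles into which its short diagonal cuts it. -/
def cells : Face → Finset (Finset Pt)
  | triangle p i => {cell p i.val}
  | quadrangle p i =>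
      {cell p i.val, {p + dir i.val, p + dir i.val + dir (i.val + 1), p + dir (i.val + 1)}}

/-- The inner angle of a face at its `j`-th corner. -/
noncomputable def angle (f : Face) (j : ℕ) : ℝ :=
  EuclideanGeometry.angle (pos (f.corner (j + f.size - 1))) (pos (f.corner j))
    (pos (f.corner (j + 1)))

end Face

/-- The vertices of the plane graph formed by a set of faces. -/
def verts (B : Finset Face) : Finset Pt := B.biUnion Face.verts

/-- The edges of the plane graph formed by a set of faces. -/
def edges (B : Finset Face) : Finset (Sym2 Pt) := B.biUnion Face.edges

/-- The degree of a vertex in the plane graph formed by `B`. -/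
def degree (B : Finset Face) (v : Pt) : ℕ := ((edges B).filter fun e => v ∈ e).card

/-- `v` is an inner vertex: everything around `v` (the six unit grid triangles at `v`)
belongs to faces of `B`. -/
def IsInner (B : Finset Face) (v : Pt) : Prop := ∀ n : ℕ, ∃ f ∈ B, cell v n ∈ f.cells

/-- A `TR`-class: a finite set of non-overlapping triangles and quadrangles with inner angles in
`{π/3, 2π/3}` on the regular triangular grid such that each inner vertex has degree `5` and each
outer (that is, not inner) vertex has degree at most `5`. No connectedness is required. -/
structure IsTRClass (B : Finset Face) : Prop where
  nonoverlapping : ∀ f ∈ B, ∀ g ∈ B, f ≠ g → Disjoint f.cells g.cells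
  degree_inner : ∀ v ∈ verts B, IsInner B v → degree B v = 5
  degree_outer : ∀ v ∈ verts B, ¬ IsInner B v → degree B v ≤ 5

/-- The contribution of a face arc of an `a`-gon. -/
def contribution (a : ℕ) : ℚ := (10 - 3 * (a : ℚ)) / a

/-- `σ`: the sum of the contributions of all face arcs (pairs of a face of `B` and a corner). -/
def sigma (B : Finset Face) : ℚ := ∑ f ∈ B, ∑ _j ∈ Finset.range f.size, contribution f.size

/-- `k`: the number of outer edges, i.e. of edges lying in exactly one face of `B`. -/
def outerEdges (B : Finset Face) : ℕ :=
  ((edges B).filter fun e => (B.filter fun f => e ∈ f.edges).card = 1).card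

/-- `τ`: the number of free valencies. -/
def freeValencies (B : Finset Face) : ℤ := ∑ v ∈ verts B, (5 - (degree B v : ℤ))

/-- The graph on the faces of `B` at the vertex `v`; two of them are adjacent if they have
a common edge. -/
def faceGraph (B : Finset Face) (v : Pt) : SimpleGraph {f : Face // f ∈ B ∧ v ∈ f.verts} where
  Adj f g := f ≠ g ∧ ∃ e, e ∈ f.1.edges ∧ e ∈ g.1.edges
  symm := ⟨fun _ _ h => ⟨h.1.symm, h.2.imp fun _ he => ⟨he.2, he.1⟩⟩⟩
  loopless := ⟨fun _ h => h.1 rfl⟩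

/-- A vertex is of special type if the faces of `B` at it do not form a connected graph. -/
def IsSpecial (B : Finset Face) (v : Pt) : Prop := ¬ (faceGraph B v).Connected

open Classical in
/-- `b₁`: the number of vertices of special type. -/
noncomputable def specialVertices (B : Finset Face) : ℕ :=
  ((verts B).filter fun v => IsSpecial B v).card

open Classical in
/-- `b₂`: the number of inner angles `2π/3` of faces of `B` at outer vertices. -/
noncomputable def outerObtuseAngles (B : Finset Face) : ℕ :=
  ∑ f ∈ B, ((Finset.range f.size).filter fun j =>
    ¬ IsInner B (f.corner j) ∧ f.angle j = 2 * Real.pi / 3).card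

end TriGrid

/-!
The formula is a sum of local identities, one for each vertex.

At a face, `3σ` can be distributed over the corners so that the share of a corner depends on its
angle only: `1` for an angle `π/3` and `-4` for an angle `2π/3`. A triangle then receives
`3 = 3 * 1` and a quadrangle `2 - 8 = 3 * (-2)` (`Face.three_mul_contribution`). An outer edge gives
half of its share `-4` to each end, and `τ`, `b₁`, `b₂` are sums over vertices or corners already.
It remains to see that the shares of each vertex `v` add up to zero
(`IsTRClass.local_identity`).

The six unit triangles at `v` are its sectors. A face with corner `v` occupies one sector, or two
consecutive ones if its angle is `2π/3`. Let `s` be the set of sectors covered by the faces, let `o`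
be the number of angles `2π/3` at `v`, and let `2r` be the number of boundary points of `s`. Then
`v` lies on `|s| - o` faces and on `2r` outer edges, and its degree is the number `|s| + r` of spokes
touching `s` minus the number `o` of spokes interior to a face (`IsTRClass.card_coveredSectors`,
`IsTRClass.card_outerEdges_at`, `IsTRClass.degree_add_obtuseCount`). The local identity becomes
`5 - 5r + 5[v special] - 5[v inner]o = 0`. If `v` is inner, all sectors are covered, hence `r = 0`,
`v` is not special, and degree `5` means `o = 1`. If `v` is outer, then `r` is the number of cyclic
runs of `s`, which correspond to the components of the graph of faces at `v`
(`IsTRClass.not_isSpecial`, `IsTRClass.isSpecial`); three runs would force degree `6`, so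
`r = 1` or `r = 2`, the latter exactly if `v` is special.

Statements about a single face are translated to the origin and checked on the eighteen faces
there; statements about cyclic patterns are checked on the 64 sets of sectors.
-/

namespace TriGrid

/-! ### Translations and the faces at the origin -/

/-- The translate of a face by the vector `t`. -/
def Face.shift (t : Pt) : Face → Face
  | .triangle p i => .triangle (t + p) i
  | .quadrangle p i => .quadrangle (t + p) i

theorem Face.size_shift (t : Pt) (f : Face) : (f.shift t).size = f.size := by
  cases f <;> rfl

theorem Face.corner_shift (t : Pt) (f : Face) (j : ℕ) :
    (f.shift t).corner j = t + f.corner j := by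
  cases f with
  | triangle p i =>
    simp only [Face.shift, Face.corner]
    generalize Fin.ofNat 3 j = k
    fin_cases k <;> simp [add_assoc]
  | quadrangle p i =>
    simp only [Face.shift, Face.corner]
    generalize Fin.ofNat 4 j = k
    fin_cases k <;> simp [add_assoc]

theorem Face.verts_shift (t : Pt) (f : Face) :
    (f.shift t).verts = f.verts.image (t + ·) := by
  simp only [Face.verts, Face.size_shift, Finset.image_image]
  exact Finset.image_congr fun j _ => Face.corner_shift t f j

theorem Face.edges_shift (t : Pt) (f : Face) :
    (f.shift t).edges = f.edges.image (Sym2.map (t + ·)) := by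
  simp only [Face.edges, Face.size_shift, Finset.image_image]
  refine Finset.image_congr fun j _ => ?_
  simp [Face.corner_shift]

theorem cell_add (t v : Pt) (n : ℕ) : cell (t + v) n = (cell v n).image (t + ·) := by
  simp [cell, Finset.image_insert, add_assoc]

theorem Face.cells_shift (t : Pt) (f : Face) :
    (f.shift t).cells = f.cells.image (Finset.image (t + ·)) := by
  cases f with
  | triangle p i => simp [Face.shift, Face.cells, cell_add]
  | quadrangle p i =>
    simp [Face.shift, Face.cells, cell_add, Finset.image_insert, add_assoc]

theorem Face.mem_verts_shift (t v : Pt) (f : Face) :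
    t + v ∈ (f.shift t).verts ↔ v ∈ f.verts := by
  rw [Face.verts_shift, Finset.mem_image]
  simp

theorem Face.cell_mem_cells_shift (t v : Pt) (n : ℕ) (f : Face) :
    cell (t + v) n ∈ (f.shift t).cells ↔ cell v n ∈ f.cells := by
  rw [Face.cells_shift, cell_add,
    (Finset.image_injective (add_right_injective t)).mem_finset_image]

theorem Face.disjoint_cells_shift (t : Pt) (f g : Face) :
    Disjoint (f.shift t).cells (g.shift t).cells ↔ Disjoint f.cells g.cells := by
  rw [Face.cells_shift, Face.cells_shift,
    Finset.disjoint_image (Finset.image_injective (add_right_injective t))]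

/-- The five faces whose base point is the origin, one for each shape and orientation. -/
def baseFaces : Finset Face :=
  Finset.univ.image (Face.triangle 0) ∪ Finset.univ.image (Face.quadrangle 0)

/-- The faces that have the origin as a corner. -/
def facesAtOrigin : Finset Face :=
  baseFaces.biUnion fun f => f.verts.image fun w => f.shift (-w)

theorem Face.exists_eq_shift_base (f : Face) : ∃ p, ∃ g ∈ baseFaces, f = g.shift p := by
  cases f with
  | triangle p i => exact ⟨p, .triangle 0 i, by simp [baseFaces], by simp [Face.shift]⟩
  | quadrangle p i => exact ⟨p, .quadrangle 0 i, by simp [baseFaces], by simp [Face.shift]⟩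

theorem Face.shift_shift (s t : Pt) (f : Face) : (f.shift t).shift s = f.shift (s + t) := by
  cases f <;> simp [Face.shift, add_assoc]

/-- Moving a corner `v` to the origin reduces every statement about a face at `v` to a check of
`facesAtOrigin`. -/
theorem Face.exists_eq_shift_of_mem_verts {f : Face} {v : Pt} (hv : v ∈ f.verts) :
    ∃ g ∈ facesAtOrigin, f = g.shift v := by
  obtain ⟨p, g, hg, rfl⟩ := f.exists_eq_shift_base
  rw [Face.verts_shift, Finset.mem_image] at hv
  obtain ⟨w, hw, rfl⟩ := hv
  refine ⟨g.shift (-w), ?_, by simp [Face.shift_shift]⟩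
  exact Finset.mem_biUnion.2 ⟨g, hg, Finset.mem_image_of_mem _ hw⟩

/-! ### The sectors of a face at a vertex -/

/-- The edge from `v` in direction `dir n`. -/
def spoke (v : Pt) (n : Fin 6) : Sym2 Pt := s(v, v + dir n)

namespace Face

/-- The sectors of the face `f` at `v`: those `n` for which `f` contains the unit triangle at `v`
between the directions `dir n` and `dir (n + 1)`. This set is empty if `v` is not a corner
of `f`, it has one element at an angle `π/3` and two cyclically consecutive ones at an
angle `2π/3`. -/
def sectors (f : Face) (v : Pt) : Finset (Fin 6) :=
  Finset.univ.filter fun n => cell v n ∈ f.cells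

/-- The number of unit directions at `v` that run through the interior of `f`; it is `1` if `f` has an
angle `2π/3` at `v`, and `0` otherwise. -/
def obtuse (f : Face) (v : Pt) : ℕ :=
  (Finset.univ.filter fun n => n ∈ f.sectors v ∧ n - 1 ∈ f.sectors v).card

theorem mem_sectors {f : Face} {v : Pt} {n : Fin 6} : n ∈ f.sectors v ↔ cell v n ∈ f.cells := by
  simp [sectors]

theorem sectors_shift (t v : Pt) (f : Face) : (f.shift t).sectors (t + v) = f.sectors v := by
  ext n
  simp only [mem_sectors, cell_mem_cells_shift]

theorem sectors_shift_zero (v : Pt) (f : Face) : (f.shift v).sectors v = f.sectors 0 := by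
  simpa using sectors_shift v 0 f

theorem obtuse_shift (t v : Pt) (f : Face) : (f.shift t).obtuse (t + v) = f.obtuse v := by
  simp only [obtuse, sectors_shift]

theorem obtuse_shift_zero (v : Pt) (f : Face) : (f.shift v).obtuse v = f.obtuse 0 := by
  simpa using obtuse_shift v 0 f

theorem subset_verts_of_mem_cells {f : Face} {c : Finset Pt} (hc : c ∈ f.cells) :
    c ⊆ f.verts := by
  obtain ⟨p, g, hg, rfl⟩ := f.exists_eq_shift_base
  rw [cells_shift, Finset.mem_image] at hc
  obtain ⟨d, hd, rfl⟩ := hc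
  rw [verts_shift]
  refine Finset.image_subset_image ?_
  have : ∀ g ∈ baseFaces, ∀ d ∈ g.cells, d ⊆ g.verts := by decide +kernel
  exact this g hg d hd

theorem mem_verts_of_mem_sectors {f : Face} {v : Pt} {n : Fin 6} (h : n ∈ f.sectors v) :
    v ∈ f.verts :=
  subset_verts_of_mem_cells (mem_sectors.1 h) (by simp [cell])

theorem sectors_eq_empty {f : Face} {v : Pt} (h : v ∉ f.verts) : f.sectors v = ∅ :=
  Finset.eq_empty_of_forall_notMem fun _ hn => h (mem_verts_of_mem_sectors hn)

theorem obtuse_eq_zero {f : Face} {v : Pt} (h : v ∉ f.verts) : f.obtuse v = 0 := by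
  simp [obtuse, sectors_eq_empty h]

theorem mem_verts_of_mem_edges {f : Face} {e : Sym2 Pt} {v : Pt} (he : e ∈ f.edges)
    (hv : v ∈ e) : v ∈ f.verts := by
  obtain ⟨p, g, hg, rfl⟩ := f.exists_eq_shift_base
  rw [edges_shift, Finset.mem_image] at he
  obtain ⟨d, hd, rfl⟩ := he
  obtain ⟨w, hw, rfl⟩ := Sym2.mem_map.1 hv
  rw [mem_verts_shift]
  have : ∀ g ∈ baseFaces, ∀ d ∈ g.edges, ∀ w ∈ d.toFinset, w ∈ g.verts := by decide +kernel
  exact this g hg d hd w (by simpa using hw)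

theorem sectors_nonempty {f : Face} {v : Pt} (hv : v ∈ f.verts) : (f.sectors v).Nonempty := by
  obtain ⟨g, hg, rfl⟩ := exists_eq_shift_of_mem_verts hv
  rw [sectors_shift_zero]
  have : ∀ g ∈ facesAtOrigin, (g.sectors 0).Nonempty := by decide +kernel
  exact this g hg

/-- A face with two sectors at `v` has them cyclically consecutive. -/
theorem sectors_consecutive {f : Face} {v : Pt} {m n : Fin 6} (hm : m ∈ f.sectors v)
    (hn : n ∈ f.sectors v) : m = n ∨ m = n - 1 ∨ n = m - 1 := by
  obtain ⟨g, hg, rfl⟩ := exists_eq_shift_of_mem_verts (mem_verts_of_mem_sectors hm)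
  rw [sectors_shift_zero] at hm hn
  have : ∀ g ∈ facesAtOrigin, ∀ m ∈ g.sectors 0, ∀ n ∈ g.sectors 0,
      m = n ∨ m = n - 1 ∨ n = m - 1 := by decide +kernel
  exact this g hg m hm n hn

theorem card_sectors (f : Face) (v : Pt) :
    (f.sectors v).card = (if v ∈ f.verts then 1 else 0) + f.obtuse v := by
  by_cases hv : v ∈ f.verts
  · rw [if_pos hv]
    obtain ⟨g, hg, rfl⟩ := exists_eq_shift_of_mem_verts hv
    have h : ∀ g ∈ facesAtOrigin, (g.sectors 0).card = 1 + g.obtuse 0 := by decide +kernel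
    rw [sectors_shift_zero, obtuse_shift_zero, h g hg]
  · rw [if_neg hv, sectors_eq_empty hv, obtuse_eq_zero hv]
    rfl

theorem spoke_eq_map (v : Pt) (n : Fin 6) : spoke v n = Sym2.map (v + ·) (spoke 0 n) := by
  simp [spoke]

/-- A side of a face has the face on exactly one of its two sides. -/
theorem spoke_mem_edges_iff (f : Face) (v : Pt) (n : Fin 6) :
    spoke v n ∈ f.edges ↔ ¬ (n ∈ f.sectors v ↔ n - 1 ∈ f.sectors v) := by
  by_cases hv : v ∈ f.verts
  · obtain ⟨g, hg, rfl⟩ := exists_eq_shift_of_mem_verts hv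
    have hinj := Sym2.map.injective (add_right_injective v)
    rw [sectors_shift_zero, edges_shift, spoke_eq_map, hinj.mem_finset_image]
    have : ∀ g ∈ facesAtOrigin, ∀ n : Fin 6,
        spoke 0 n ∈ g.edges ↔ ¬ (n ∈ g.sectors 0 ↔ n - 1 ∈ g.sectors 0) := by decide +kernel
    exact this g hg n
  · rw [sectors_eq_empty hv]
    have : spoke v n ∉ f.edges := fun h => hv (mem_verts_of_mem_edges h (by simp [spoke]))
    simp [this]

theorem exists_eq_spoke {f : Face} {e : Sym2 Pt} {v : Pt} (he : e ∈ f.edges) (hv : v ∈ e) :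
    ∃ n, e = spoke v n := by
  obtain ⟨g, hg, rfl⟩ := exists_eq_shift_of_mem_verts (mem_verts_of_mem_edges he hv)
  rw [edges_shift, Finset.mem_image] at he
  obtain ⟨d, hd, rfl⟩ := he
  obtain ⟨w, hw, hw'⟩ := Sym2.mem_map.1 hv
  obtain rfl : w = 0 := by simpa using hw'
  have : ∀ g ∈ facesAtOrigin, ∀ d ∈ g.edges, 0 ∈ d.toFinset → ∃ n, d = spoke 0 n := by
    decide +kernel
  obtain ⟨n, rfl⟩ := this g hg d hd (by simpa using hw)
  exact ⟨n, (spoke_eq_map v n).symm⟩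

/-- By convexity, a common side of two non-overlapping faces passes through each of their common
corners. -/
theorem mem_of_mem_edges_of_disjoint {f g : Face} {v : Pt} (hf : v ∈ f.verts) (hg : v ∈ g.verts)
    (hfg : Disjoint f.cells g.cells) {e : Sym2 Pt} (hef : e ∈ f.edges) (heg : e ∈ g.edges) :
    v ∈ e := by
  obtain ⟨f, hf', rfl⟩ := exists_eq_shift_of_mem_verts hf
  obtain ⟨g, hg', rfl⟩ := exists_eq_shift_of_mem_verts hg
  rw [disjoint_cells_shift] at hfg
  rw [edges_shift, Finset.mem_image] at hef
  obtain ⟨d, hd, rfl⟩ := hef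
  rw [edges_shift, (Sym2.map.injective (add_right_injective v)).mem_finset_image] at heg
  have : ∀ f ∈ facesAtOrigin, ∀ g ∈ facesAtOrigin, Disjoint f.cells g.cells →
      ∀ d ∈ f.edges, d ∈ g.edges → 0 ∈ d.toFinset := by decide +kernel
  have h0 := this f hf' g hg' hfg d hd heg
  exact Sym2.mem_map.2 ⟨0, by simpa using h0, by simp⟩

end Face

theorem spoke_injective (v : Pt) : Function.Injective (spoke v) := by
  have h0 : ∀ m n : Fin 6, spoke 0 m = spoke 0 n → m = n := by decide +kernel
  intro m n h
  rw [Face.spoke_eq_map v m, Face.spoke_eq_map v n] at h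
  exact h0 m n (Sym2.map.injective (add_right_injective v) h)

/-! ### Angles -/

/-- Twice the Euclidean inner product of two grid vectors. -/
def form (x y : Pt) : ℤ := 2 * x.1 * y.1 + x.1 * y.2 + x.2 * y.1 + 2 * x.2 * y.2

theorem inner_pos_sub (a b c : Pt) :
    inner ℝ (pos a - pos b) (pos c - pos b) = (form (a - b) (c - b) : ℝ) / 2 := by
  have h3 : Real.sqrt 3 * Real.sqrt 3 = 3 := Real.mul_self_sqrt (by norm_num)
  simp only [Complex.inner, pos, form, Complex.mul_re, Complex.conj_re, Complex.conj_im,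
    Complex.sub_re, Complex.sub_im, Prod.fst_sub, Prod.snd_sub]
  push_cast
  linear_combination ((a.2 : ℝ) - b.2) * (c.2 - b.2) / 4 * h3

theorem norm_pos_sub {a b : Pt} (h : form (a - b) (a - b) = 2) : ‖pos a - pos b‖ = 1 := by
  have h1 := inner_pos_sub a b a
  rw [h, real_inner_self_eq_norm_sq] at h1
  norm_num at h1
  rcases h1 with h1 | h1
  · exact h1
  · linarith [norm_nonneg (pos a - pos b)]

theorem angle_eq_two_pi_div_three_iff {a b c : Pt} (ha : form (a - b) (a - b) = 2)
    (hc : form (c - b) (c - b) = 2) :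
    EuclideanGeometry.angle (pos a) (pos b) (pos c) = 2 * Real.pi / 3 ↔
      form (a - b) (c - b) = -1 := by
  have hcos : Real.cos (2 * Real.pi / 3) = -(1 / 2) := by
    rw [← Real.cos_pi_div_three, ← Real.cos_pi_sub]
    congr 1
    ring
  have key : Real.cos (EuclideanGeometry.angle (pos a) (pos b) (pos c)) =
      (form (a - b) (c - b) : ℝ) / 2 := by
    rw [EuclideanGeometry.angle, InnerProductGeometry.cos_angle, vsub_eq_sub, vsub_eq_sub,
      inner_pos_sub, norm_pos_sub ha, norm_pos_sub hc]
    simp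
  have hmem : (2 * Real.pi / 3) ∈ Set.Icc 0 Real.pi :=
    ⟨by positivity, by linarith [Real.pi_pos]⟩
  rw [← Real.injOn_cos.eq_iff
    ⟨EuclideanGeometry.angle_nonneg _ _ _, EuclideanGeometry.angle_le_pi _ _ _⟩ hmem, key, hcos]
  constructor
  · intro h
    have : (form (a - b) (c - b) : ℝ) = ((-1 : ℤ) : ℝ) := by push_cast; linarith
    exact_mod_cast this
  · intro h
    rw [h]
    norm_num

namespace Face

/-- The metric meaning of `Face.obtuse`: it singles out the angles `2π/3`. -/
theorem angle_eq_iff {f : Face} {j : ℕ} (hj : j < f.size) :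
    f.angle j = 2 * Real.pi / 3 ↔ f.obtuse (f.corner j) = 1 := by
  obtain ⟨p, g, hg, rfl⟩ := f.exists_eq_shift_base
  rw [size_shift] at hj
  have h : ∀ g ∈ baseFaces, ∀ j < g.size,
      form (g.corner (j + g.size - 1) - g.corner j) (g.corner (j + g.size - 1) - g.corner j) = 2 ∧
      form (g.corner (j + 1) - g.corner j) (g.corner (j + 1) - g.corner j) = 2 ∧
      (form (g.corner (j + g.size - 1) - g.corner j) (g.corner (j + 1) - g.corner j) = -1 ↔
        g.obtuse (g.corner j) = 1) := by decide +kernel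
  obtain ⟨h1, h2, h3⟩ := h g hg j hj
  rw [angle, angle_eq_two_pi_div_three_iff]
  · simpa only [corner_shift, size_shift, add_sub_add_left_eq_sub, obtuse_shift] using h3
  · simpa only [corner_shift, size_shift, add_sub_add_left_eq_sub] using h1
  · simpa only [corner_shift, size_shift, add_sub_add_left_eq_sub] using h2

theorem corner_injOn (f : Face) : Set.InjOn f.corner (Finset.range f.size) := by
  obtain ⟨p, g, hg, rfl⟩ := f.exists_eq_shift_base
  have h : ∀ g ∈ baseFaces, ∀ i < g.size, ∀ j < g.size, g.corner i = g.corner j → i = j := by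
    decide +kernel
  intro i hi j hj hij
  simp only [size_shift, Finset.coe_range, Set.mem_Iio] at hi hj
  rw [corner_shift, corner_shift, add_right_inj] at hij
  exact h g hg i hi j hj hij

/-- The contribution of a face, as a sum over its corners of a term that depends on the angle
only: an angle `π/3` counts `1` and an angle `2π/3` counts `-4`. -/
theorem three_mul_contribution (f : Face) :
    3 * ∑ _j ∈ Finset.range f.size, contribution f.size =
      (f.verts.card : ℚ) - 5 * ∑ v ∈ f.verts, (f.obtuse v : ℚ) := by
  have hv : f.verts.card = f.size := by
    rw [Face.verts, Finset.card_image_of_injOn f.corner_injOn, Finset.card_range]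
  -- A triangle has no angle `2π/3` and a quadrangle has two.
  have ho : ∑ v ∈ f.verts, f.obtuse v = 2 * (f.size - 3) := by
    obtain ⟨p, g, hg, rfl⟩ := f.exists_eq_shift_base
    rw [verts_shift, Finset.sum_image fun _ _ _ _ h => add_right_injective p h, size_shift]
    simp only [obtuse_shift]
    have : ∀ g ∈ baseFaces, ∑ v ∈ g.verts, g.obtuse v = 2 * (g.size - 3) := by decide +kernel
    exact this g hg
  have hoq : ∑ v ∈ f.verts, (f.obtuse v : ℚ) = ((2 * (f.size - 3) : ℕ) : ℚ) := by
    rw [← ho]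
    push_cast
    rfl
  rw [hoq, hv]
  cases f <;> simp [Face.size, contribution] <;> norm_num

end Face

/-! ### Cyclic patterns of six sectors -/

/-- The number of boundary points of a set of cyclically arranged sectors. -/
def boundary (s : Finset (Fin 6)) : ℕ :=
  (Finset.univ.filter fun n => ¬ (n ∈ s ↔ n - 1 ∈ s)).card

/-- The number of spokes that are on the border of at least one sector of `s`. -/
def touched (s : Finset (Fin 6)) : ℕ :=
  (Finset.univ.filter fun n => n ∈ s ∨ n - 1 ∈ s).card

/-- A sector has two bordering spokes, and a spoke touched by `s` borders two sectors of `s` unless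
it is a boundary point. -/
theorem two_mul_touched (s : Finset (Fin 6)) : 2 * touched s = 2 * s.card + boundary s := by
  revert s
  decide +kernel

/-- A set of sectors that is neither empty nor full has one, two or three cyclic runs; in the case
of three runs, sectors of the set and of its complement alternate. -/
theorem boundary_cases {s : Finset (Fin 6)} (hs : s.Nonempty) (hs' : s ≠ Finset.univ) :
    boundary s = 2 ∨ boundary s = 4 ∨
      (touched s = 6 ∧ ∀ n, ¬ (n ∈ s ∧ n - 1 ∈ s)) := by
  revert s
  decide +kernel

/-- A set of sectors with at most two boundary points is a cyclic interval. -/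
theorem exists_interval {s : Finset (Fin 6)} (hs : s.Nonempty) (h : boundary s ≤ 2) :
    ∃ a : Fin 6, ∃ k ≤ 6, s = (Finset.range k).image fun l => a + Fin.ofNat 6 l := by
  revert s
  decide +kernel

/-- A set of sectors with at least four boundary points falls into two separated parts. -/
theorem exists_separation {s : Finset (Fin 6)} (h : 4 ≤ boundary s) :
    ∃ t : Finset (Fin 6), (∀ n, n ∈ s → n - 1 ∈ s → (n ∈ t ↔ n - 1 ∈ t)) ∧
      (∃ i ∈ s, i ∈ t) ∧ ∃ j ∈ s, j ∉ t := by
  revert s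
  decide +kernel

/-! ### The sectors at a vertex covered by a set of faces -/

/-- The sectors at `v` that are covered by the faces of `B`. -/
def coveredSectors (B : Finset Face) (v : Pt) : Finset (Fin 6) :=
  B.biUnion fun f => f.sectors v

/-- The number of angles `2π/3` of faces of `B` with apex `v`. -/
def obtuseCount (B : Finset Face) (v : Pt) : ℕ := ∑ f ∈ B, f.obtuse v

/-- The edges lying in exactly one face of `B`. -/
def outerEdgeSet (B : Finset Face) : Finset (Sym2 Pt) :=
  (edges B).filter fun e => (B.filter fun f => e ∈ f.edges).card = 1

variable {B : Finset Face} {v : Pt}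

theorem mem_coveredSectors {n : Fin 6} :
    n ∈ coveredSectors B v ↔ ∃ f ∈ B, n ∈ f.sectors v := by
  simp [coveredSectors]

theorem coveredSectors_nonempty (hv : v ∈ verts B) : (coveredSectors B v).Nonempty := by
  obtain ⟨f, hf, hvf⟩ := Finset.mem_biUnion.1 hv
  obtain ⟨n, hn⟩ := Face.sectors_nonempty hvf
  exact ⟨n, mem_coveredSectors.2 ⟨f, hf, hn⟩⟩

theorem dir_mod (n : ℕ) : dir (n % 6) = dir n := by
  have : Fin.ofNat 6 (n % 6) = Fin.ofNat 6 n := by ext; simp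
  rw [dir, dir, this]

theorem cell_mod (v : Pt) (n : ℕ) : cell v (n % 6) = cell v n := by
  have h : dir (n % 6 + 1) = dir (n + 1) := by
    rw [← dir_mod (n % 6 + 1), ← dir_mod (n + 1), Nat.mod_add_mod]
  rw [cell, cell, dir_mod, h]

theorem isInner_iff : IsInner B v ↔ coveredSectors B v = Finset.univ := by
  rw [Finset.eq_univ_iff_forall]
  constructor
  · intro h n
    obtain ⟨f, hf, hn⟩ := h n
    exact mem_coveredSectors.2 ⟨f, hf, Face.mem_sectors.2 hn⟩
  · intro h n
    obtain ⟨f, hf, hn⟩ := mem_coveredSectors.1 (h (Fin.ofNat 6 n))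
    refine ⟨f, hf, ?_⟩
    have := Face.mem_sectors.1 hn
    rwa [Fin.val_ofNat, cell_mod] at this

theorem IsTRClass.eq_of_mem_sectors (hB : IsTRClass B) {f g : Face} (hf : f ∈ B) (hg : g ∈ B)
    {n : Fin 6} (hfn : n ∈ f.sectors v) (hgn : n ∈ g.sectors v) : f = g := by
  by_contra hne
  exact Finset.disjoint_left.1 (hB.nonoverlapping f hf g hg hne) (Face.mem_sectors.1 hfn)
    (Face.mem_sectors.1 hgn)

theorem IsTRClass.card_coveredSectors (hB : IsTRClass B) (v : Pt) :
    (coveredSectors B v).card = (B.filter fun f => v ∈ f.verts).card + obtuseCount B v := by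
  rw [coveredSectors, Finset.card_biUnion]
  · simp only [Face.card_sectors, Finset.sum_add_distrib, obtuseCount, Finset.card_filter]
  · intro f hf g hg hne
    exact Finset.disjoint_left.2 fun n hfn hgn => hne (hB.eq_of_mem_sectors hf hg hfn hgn)

/-- Each angle `2π/3` at `v` has exactly one direction in its interior. -/
theorem IsTRClass.card_interior_directions (hB : IsTRClass B) (v : Pt) :
    (Finset.univ.filter fun n => ∃ f ∈ B, n ∈ f.sectors v ∧ n - 1 ∈ f.sectors v).card =
      obtuseCount B v := by
  have h : (Finset.univ.filter fun n => ∃ f ∈ B, n ∈ f.sectors v ∧ n - 1 ∈ f.sectors v) =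
      B.biUnion fun f => Finset.univ.filter fun n => n ∈ f.sectors v ∧ n - 1 ∈ f.sectors v := by
    ext n
    simp
  rw [h, Finset.card_biUnion]
  · rfl
  · intro f hf g hg hne
    refine Finset.disjoint_left.2 fun n hfn hgn => hne ?_
    exact hB.eq_of_mem_sectors hf hg (Finset.mem_filter.1 hfn).2.1 (Finset.mem_filter.1 hgn).2.1

theorem mem_edges {e : Sym2 Pt} : e ∈ edges B ↔ ∃ f ∈ B, e ∈ f.edges := by
  simp [edges]

/-- The edges at `v` are the spokes that touch a covered sector, except those that bisect an
angle `2π/3`. -/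
theorem IsTRClass.spoke_mem_edges_iff (hB : IsTRClass B) (v : Pt) (n : Fin 6) :
    spoke v n ∈ edges B ↔ (n ∈ coveredSectors B v ∨ n - 1 ∈ coveredSectors B v) ∧
      ¬ ∃ f ∈ B, n ∈ f.sectors v ∧ n - 1 ∈ f.sectors v := by
  simp only [mem_edges, Face.spoke_mem_edges_iff, mem_coveredSectors]
  constructor
  · rintro ⟨f, hf, hn⟩
    constructor
    · by_cases h : n ∈ f.sectors v
      · exact Or.inl ⟨f, hf, h⟩
      · exact Or.inr ⟨f, hf, by tauto⟩
    · rintro ⟨g, hg, h1, h2⟩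
      by_cases h : n ∈ f.sectors v
      · obtain rfl := hB.eq_of_mem_sectors hf hg h h1
        tauto
      · have h' : n - 1 ∈ f.sectors v := by tauto
        obtain rfl := hB.eq_of_mem_sectors hf hg h' h2
        tauto
  · rintro ⟨⟨f, hf, h⟩ | ⟨f, hf, h⟩, hno⟩
    · exact ⟨f, hf, fun h' => hno ⟨f, hf, h, h'.1 h⟩⟩
    · exact ⟨f, hf, fun h' => hno ⟨f, hf, h'.2 h, h⟩⟩

/-- The outer edges at `v` are the boundary points of the covered sectors, since a spoke between two
covered sectors lies in two faces or in none. -/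
theorem IsTRClass.spoke_mem_outerEdgeSet_iff (hB : IsTRClass B) (v : Pt) (n : Fin 6) :
    spoke v n ∈ outerEdgeSet B ↔ ¬ (n ∈ coveredSectors B v ↔ n - 1 ∈ coveredSectors B v) := by
  have hmem : spoke v n ∈ outerEdgeSet B ↔
      (B.filter fun f => spoke v n ∈ f.edges).card = 1 := by
    refine Finset.mem_filter.trans (and_iff_right_of_imp fun h => ?_)
    obtain ⟨f, hf⟩ := Finset.card_pos.1 (h.symm ▸ Nat.one_pos)
    exact mem_edges.2 ⟨f, Finset.mem_filter.1 hf⟩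
  rw [hmem, Finset.card_eq_one]
  constructor
  · rintro ⟨f, hf⟩ hiff
    have huniq : ∀ g ∈ B, spoke v n ∈ g.edges → g = f := fun g hg h =>
      Finset.mem_singleton.1 (hf ▸ Finset.mem_filter.2 ⟨hg, h⟩)
    obtain ⟨hfB, hfe⟩ := Finset.mem_filter.1 (hf.symm ▸ Finset.mem_singleton_self f)
    simp only [Face.spoke_mem_edges_iff] at huniq hfe
    by_cases h : n ∈ f.sectors v
    · obtain ⟨g, hg, hgn⟩ := mem_coveredSectors.1 (hiff.1 (mem_coveredSectors.2 ⟨f, hfB, h⟩))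
      have hgf : g ≠ f := by rintro rfl; tauto
      exact hgf (huniq g hg fun h' => hgf (hB.eq_of_mem_sectors hg hfB (h'.2 hgn) h))
    · have h1 : n - 1 ∈ f.sectors v := by tauto
      obtain ⟨g, hg, hgn⟩ := mem_coveredSectors.1 (hiff.2 (mem_coveredSectors.2 ⟨f, hfB, h1⟩))
      have hgf : g ≠ f := by rintro rfl; tauto
      exact hgf (huniq g hg fun h' => hgf (hB.eq_of_mem_sectors hg hfB (h'.1 hgn) h1))
  · intro h
    simp only [Face.spoke_mem_edges_iff]
    by_cases hn : n ∈ coveredSectors B v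
    · have hn1 : ∀ g ∈ B, n - 1 ∉ g.sectors v := fun g hg hgn =>
        h (iff_of_true hn (mem_coveredSectors.2 ⟨g, hg, hgn⟩))
      obtain ⟨f, hf, hfn⟩ := mem_coveredSectors.1 hn
      refine ⟨f, Finset.eq_singleton_iff_unique_mem.2
        ⟨Finset.mem_filter.2 ⟨hf, fun h' => hn1 f hf (h'.1 hfn)⟩, fun g hg => ?_⟩⟩
      obtain ⟨hg, hgn⟩ := Finset.mem_filter.1 hg
      have := hn1 g hg
      exact hB.eq_of_mem_sectors hg hf (by tauto) hfn
    · have hn1 : ∀ g ∈ B, n ∉ g.sectors v := fun g hg hgn =>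
        hn (mem_coveredSectors.2 ⟨g, hg, hgn⟩)
      obtain ⟨f, hf, hfn⟩ : ∃ f ∈ B, n - 1 ∈ f.sectors v := mem_coveredSectors.1 (by tauto)
      refine ⟨f, Finset.eq_singleton_iff_unique_mem.2
        ⟨Finset.mem_filter.2 ⟨hf, fun h' => hn1 f hf (h'.2 hfn)⟩, fun g hg => ?_⟩⟩
      obtain ⟨hg, hgn⟩ := Finset.mem_filter.1 hg
      have := hn1 g hg
      exact hB.eq_of_mem_sectors hg hf (by tauto) hfn

theorem card_filter_mem_eq_card_spokes {E : Finset (Sym2 Pt)} (hE : E ⊆ edges B) (v : Pt) :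
    (E.filter fun e => v ∈ e).card = (Finset.univ.filter fun n => spoke v n ∈ E).card := by
  rw [← Finset.card_image_of_injective _ (spoke_injective v)]
  congr 1
  ext e
  simp only [Finset.mem_filter, Finset.mem_image, Finset.mem_univ, true_and]
  constructor
  · rintro ⟨he, hv⟩
    obtain ⟨f, -, hf⟩ := mem_edges.1 (hE he)
    obtain ⟨n, rfl⟩ := Face.exists_eq_spoke hf hv
    exact ⟨n, he, rfl⟩
  · rintro ⟨n, hn, rfl⟩
    exact ⟨hn, by simp [spoke]⟩

/-- Every edge of the graph has exactly two ends among its vertices. -/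
theorem sum_card_filter_mem {E : Finset (Sym2 Pt)} (hE : E ⊆ edges B) :
    ∑ v ∈ verts B, (E.filter fun e => v ∈ e).card = 2 * E.card := by
  have h : ∀ e ∈ E, ((verts B).filter fun v => v ∈ e).card = 2 := by
    intro e he
    obtain ⟨f, hfB, hf⟩ := mem_edges.1 (hE he)
    have hfilter : ((verts B).filter fun v => v ∈ e) = e.toFinset := by
      ext v
      simp only [Finset.mem_filter, Sym2.mem_toFinset, and_iff_right_iff_imp]
      exact fun hv => Finset.mem_biUnion.2 ⟨f, hfB, Face.mem_verts_of_mem_edges hf hv⟩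
    rw [hfilter]
    refine Sym2.card_toFinset_of_not_isDiag e ?_
    obtain ⟨n, hn⟩ := Face.exists_eq_spoke hf (Sym2.out_fst_mem e)
    have hdir : ∀ n : Fin 6, dir n ≠ 0 := by decide
    rw [hn, spoke, Sym2.mk_isDiag_iff]
    intro hdiag
    exact hdir n (by simpa using hdiag)
  have := Finset.sum_card_bipartiteAbove_eq_sum_card_bipartiteBelow (s := verts B) (t := E)
    (fun v e => v ∈ e)
  simp only [Finset.bipartiteAbove, Finset.bipartiteBelow] at this
  rw [this, Finset.sum_congr rfl h, Finset.sum_const, smul_eq_mul, mul_comm]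

theorem outerEdgeSet_subset (B : Finset Face) : outerEdgeSet B ⊆ edges B :=
  Finset.filter_subset _ _

theorem IsTRClass.card_outerEdges_at (hB : IsTRClass B) (v : Pt) :
    ((outerEdgeSet B).filter fun e => v ∈ e).card = boundary (coveredSectors B v) := by
  rw [card_filter_mem_eq_card_spokes (outerEdgeSet_subset B), boundary]
  simp only [hB.spoke_mem_outerEdgeSet_iff]

theorem IsTRClass.degree_add_obtuseCount (hB : IsTRClass B) (v : Pt) :
    degree B v + obtuseCount B v = touched (coveredSectors B v) := by
  rw [degree, card_filter_mem_eq_card_spokes subset_rfl, ← hB.card_interior_directions, touched,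
    ← Finset.card_union_of_disjoint]
  · congr 1
    ext n
    simp only [Finset.mem_union, Finset.mem_filter, Finset.mem_univ, true_and,
      hB.spoke_mem_edges_iff]
    constructor
    · rintro (h | ⟨f, hf, h, -⟩)
      · exact h.1
      · exact Or.inl (mem_coveredSectors.2 ⟨f, hf, h⟩)
    · tauto
  · refine Finset.disjoint_left.2 fun n h h' => ?_
    simp only [Finset.mem_filter, Finset.mem_univ, true_and, hB.spoke_mem_edges_iff] at h h'
    exact h.2 h'

/-! ### Vertices of special type -/

/-- Two faces that cover consecutive sectors are equal or share the spoke between them. -/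
theorem IsTRClass.reachable_of_consecutive (hB : IsTRClass B)
    {f g : {f : Face // f ∈ B ∧ v ∈ f.verts}} {n : Fin 6} (hf : n - 1 ∈ f.1.sectors v)
    (hg : n ∈ g.1.sectors v) : (faceGraph B v).Reachable f g := by
  by_cases hfg : f = g
  · rw [hfg]
  · refine SimpleGraph.Adj.reachable ⟨hfg, spoke v n, ?_, ?_⟩
    · rw [Face.spoke_mem_edges_iff]
      exact fun h => hfg (Subtype.ext (hB.eq_of_mem_sectors f.2.1 g.2.1 (h.2 hf) hg))
    · rw [Face.spoke_mem_edges_iff]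
      exact fun h => hfg (Subtype.ext (hB.eq_of_mem_sectors f.2.1 g.2.1 hf (h.1 hg)))

/-- If the covered sectors form a single cyclic run, then the faces at `v` can be walked through in
the order of the sectors. -/
theorem IsTRClass.not_isSpecial (hB : IsTRClass B) (hv : v ∈ verts B)
    (h : boundary (coveredSectors B v) ≤ 2) : ¬ IsSpecial B v := by
  obtain ⟨a, k, -, hak⟩ := exists_interval (coveredSectors_nonempty hv) h
  have hface : ∀ l < k, ∃ f : {f : Face // f ∈ B ∧ v ∈ f.verts},
      a + Fin.ofNat 6 l ∈ f.1.sectors v := by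
    intro l hl
    have : a + Fin.ofNat 6 l ∈ coveredSectors B v :=
      hak ▸ Finset.mem_image_of_mem _ (Finset.mem_range.2 hl)
    obtain ⟨f, hf, hn⟩ := mem_coveredSectors.1 this
    exact ⟨⟨f, hf, Face.mem_verts_of_mem_sectors hn⟩, hn⟩
  have hsub : ∀ l, a + Fin.ofNat 6 (l + 1) - 1 = a + Fin.ofNat 6 l := by
    intro l
    have : Fin.ofNat 6 (l + 1) = Fin.ofNat 6 l + 1 := by
      ext
      simp [Fin.val_add]
    rw [this, ← add_assoc, add_sub_cancel_right]
  have hk : 0 < k := by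
    obtain ⟨n, hn⟩ := coveredSectors_nonempty hv
    rw [hak, Finset.mem_image] at hn
    obtain ⟨l, hl, -⟩ := hn
    exact (Nat.zero_le l).trans_lt (Finset.mem_range.1 hl)
  obtain ⟨f₀, hf₀⟩ := hface 0 hk
  have hreach : ∀ l < k, ∀ f : {f : Face // f ∈ B ∧ v ∈ f.verts},
      a + Fin.ofNat 6 l ∈ f.1.sectors v → (faceGraph B v).Reachable f₀ f := by
    intro l
    induction l with
    | zero =>
      intro _ f hf
      rw [Subtype.ext (hB.eq_of_mem_sectors f₀.2.1 f.2.1 hf₀ hf)]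
    | succ l ih =>
      intro hl f hf
      obtain ⟨g, hg⟩ := hface l (Nat.lt_of_succ_lt hl)
      exact (ih (Nat.lt_of_succ_lt hl) g hg).trans
        (hB.reachable_of_consecutive (by rwa [hsub]) hf)
  have hall : ∀ f, (faceGraph B v).Reachable f₀ f := by
    intro f
    obtain ⟨n, hn⟩ := Face.sectors_nonempty f.2.2
    have hn' : n ∈ coveredSectors B v := mem_coveredSectors.2 ⟨f.1, f.2.1, hn⟩
    rw [hak, Finset.mem_image] at hn'
    obtain ⟨l, hl, rfl⟩ := hn'
    exact hreach l (Finset.mem_range.1 hl) f hn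
  have : Nonempty {f : Face // f ∈ B ∧ v ∈ f.verts} := ⟨f₀⟩
  exact not_not.2 ⟨fun f g => (hall f).symm.trans (hall g)⟩

/-- If the covered sectors fall into two separated parts, then no common edge leads from a face in
one part to a face in the other. -/
theorem IsTRClass.isSpecial (hB : IsTRClass B) (h : 4 ≤ boundary (coveredSectors B v)) :
    IsSpecial B v := by
  obtain ⟨t, ht, ⟨i, hi, hit⟩, j, hj, hjt⟩ := exists_separation h
  obtain ⟨f, hfB, hf⟩ := mem_coveredSectors.1 hi
  obtain ⟨g, hgB, hg⟩ := mem_coveredSectors.1 hj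
  have hcov : ∀ f : {f : Face // f ∈ B ∧ v ∈ f.verts}, ∀ n ∈ f.1.sectors v,
      n ∈ coveredSectors B v := fun f n hn => mem_coveredSectors.2 ⟨f.1, f.2.1, hn⟩
  -- All sectors of one face lie on the same side of the separation.
  have hsame : ∀ f : {f : Face // f ∈ B ∧ v ∈ f.verts}, ∀ m ∈ f.1.sectors v,
      ∀ n ∈ f.1.sectors v, m ∈ t → n ∈ t := by
    intro f m hm n hn hmt
    rcases Face.sectors_consecutive hm hn with rfl | rfl | rfl
    · exact hmt
    · exact (ht n (hcov f n hn) (hcov f _ hm)).2 hmt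
    · exact (ht m (hcov f m hm) (hcov f _ hn)).1 hmt
  have hadj : ∀ f g : {f : Face // f ∈ B ∧ v ∈ f.verts}, (faceGraph B v).Adj f g →
      (∃ n ∈ f.1.sectors v, n ∈ t) → ∃ n ∈ g.1.sectors v, n ∈ t := by
    rintro f g ⟨hne, e, hef, heg⟩ ⟨m, hm, hmt⟩
    have hdisj := hB.nonoverlapping f.1 f.2.1 g.1 g.2.1 fun h => hne (Subtype.ext h)
    obtain ⟨n, rfl⟩ := Face.exists_eq_spoke hef
      (Face.mem_of_mem_edges_of_disjoint f.2.2 g.2.2 hdisj hef heg)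
    rw [Face.spoke_mem_edges_iff] at hef heg
    have hd : ∀ n, n ∈ f.1.sectors v → n ∉ g.1.sectors v := fun n h h' =>
      hne (Subtype.ext (hB.eq_of_mem_sectors f.2.1 g.2.1 h h'))
    by_cases hn : n ∈ f.1.sectors v
    · have hg' : n - 1 ∈ g.1.sectors v := by
        have := hd n hn
        tauto
      exact ⟨n - 1, hg', (ht n (hcov f n hn) (hcov g _ hg')).1 (hsame f m hm n hn hmt)⟩
    · have hn' : n - 1 ∈ f.1.sectors v := by tauto
      have hg' : n ∈ g.1.sectors v := by
        have := hd _ hn'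
        tauto
      exact ⟨n, hg', (ht n (hcov g n hg') (hcov f _ hn')).2 (hsame f m hm _ hn' hmt)⟩
  intro hconn
  obtain ⟨w⟩ := hconn.preconnected ⟨f, hfB, Face.mem_verts_of_mem_sectors hf⟩
    ⟨g, hgB, Face.mem_verts_of_mem_sectors hg⟩
  have hwalk : ∀ f g : {f : Face // f ∈ B ∧ v ∈ f.verts}, (faceGraph B v).Walk f g →
      (∃ n ∈ f.1.sectors v, n ∈ t) → ∃ n ∈ g.1.sectors v, n ∈ t := by
    intro f g w
    induction w with
    | nil => exact id
    | cons h _ ih => exact fun hf => ih (hadj _ _ h hf)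
  obtain ⟨n, hn, hnt⟩ := hwalk _ _ w ⟨i, hf, hit⟩
  exact hjt (hsame ⟨g, hgB, Face.mem_verts_of_mem_sectors hg⟩ n hn j hg hnt)

/-! ### The identity at a vertex and its sum -/

open Classical in
/-- Three times the formula, distributed over the vertices, cancels at each vertex. The five terms
are the shares of `3σ`, `-4k`, `τ`, `5b₁` and `5b₂`; an outer edge gives `-2` to each of its ends.
The degree condition is needed at inner vertices, where it forces exactly one angle `2π/3`, and at
outer vertices, where it excludes three separated groups of faces. -/
theorem IsTRClass.local_identity (hB : IsTRClass B) (hv : v ∈ verts B) :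
    (((B.filter fun f => v ∈ f.verts).card : ℤ) - 5 * obtuseCount B v)
      - 2 * ((outerEdgeSet B).filter fun e => v ∈ e).card + (5 - degree B v)
      + 5 * (if IsSpecial B v then 1 else 0)
      + 5 * (if IsInner B v then 0 else obtuseCount B v) = 0 := by
  have h1 := hB.card_coveredSectors v
  have h2 := hB.degree_add_obtuseCount v
  have h3 := two_mul_touched (coveredSectors B v)
  rw [hB.card_outerEdges_at]
  by_cases hin : IsInner B v
  · have hdeg := hB.degree_inner v hv hin
    have hb : boundary (coveredSectors B v) = 0 := by
      rw [isInner_iff.1 hin]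
      decide
    have hc : (coveredSectors B v).card = 6 := by
      rw [isInner_iff.1 hin]
      decide
    rw [if_neg (hB.not_isSpecial hv (by omega)), if_pos hin]
    omega
  · have hdeg := hB.degree_outer v hv hin
    rw [if_neg hin]
    rcases boundary_cases (coveredSectors_nonempty hv) (fun h => hin (isInner_iff.2 h)) with
      hb | hb | ⟨ht, hno⟩
    · rw [if_neg (hB.not_isSpecial hv hb.le)]
      omega
    · rw [if_pos (hB.isSpecial hb.ge)]
      omega
    · -- Three separated sectors would need six edges at `v`.
      have ho : obtuseCount B v = 0 := by
        rw [← hB.card_interior_directions, Finset.card_eq_zero, Finset.filter_eq_empty_iff]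
        rintro n - ⟨f, hf, h, h'⟩
        exact hno n ⟨mem_coveredSectors.2 ⟨f, hf, h⟩, mem_coveredSectors.2 ⟨f, hf, h'⟩⟩
      omega

theorem Face.verts_subset {f : Face} (hf : f ∈ B) : f.verts ⊆ TriGrid.verts B :=
  Finset.subset_biUnion_of_mem Face.verts hf

theorem sum_card_faces (B : Finset Face) :
    ∑ v ∈ verts B, (B.filter fun f => v ∈ f.verts).card = ∑ f ∈ B, f.verts.card := by
  have := Finset.sum_card_bipartiteAbove_eq_sum_card_bipartiteBelow (s := verts B) (t := B)
    (fun v f => v ∈ f.verts)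
  simp only [Finset.bipartiteAbove, Finset.bipartiteBelow] at this
  rw [this]
  refine Finset.sum_congr rfl fun f hf => ?_
  rw [Finset.filter_mem_eq_inter, Finset.inter_eq_right.2 (Face.verts_subset hf)]

/-- Summation over the angles `2π/3`, weighted by a function `c` of the apex, by vertices and by
faces. -/
theorem sum_obtuse (c : Pt → ℕ) :
    ∑ v ∈ verts B, c v * obtuseCount B v = ∑ f ∈ B, ∑ v ∈ f.verts, c v * f.obtuse v := by
  simp only [obtuseCount, Finset.mul_sum]
  rw [Finset.sum_comm]
  refine Finset.sum_congr rfl fun f hf => (Finset.sum_subset (Face.verts_subset hf) ?_).symm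
  intro v _ hv
  rw [Face.obtuse_eq_zero hv, mul_zero]

theorem three_mul_sigma (B : Finset Face) :
    3 * sigma B = ∑ v ∈ verts B,
      (((B.filter fun f => v ∈ f.verts).card : ℚ) - 5 * obtuseCount B v) := by
  have h1 := sum_card_faces B
  have h2 := sum_obtuse (B := B) fun _ => 1
  simp only [one_mul] at h2
  rw [sigma, Finset.mul_sum, Finset.sum_congr rfl fun f _ => f.three_mul_contribution,
    Finset.sum_sub_distrib, Finset.sum_sub_distrib, ← Finset.mul_sum, ← Finset.mul_sum]
  have h1' : ∑ v ∈ verts B, ((B.filter fun f => v ∈ f.verts).card : ℚ) =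
      ∑ f ∈ B, (f.verts.card : ℚ) := by exact_mod_cast h1
  have h2' : ∑ v ∈ verts B, (obtuseCount B v : ℚ) =
      ∑ f ∈ B, ∑ v ∈ f.verts, (f.obtuse v : ℚ) := by exact_mod_cast h2
  rw [h1', h2']

theorem Face.obtuse_le_one (f : Face) (v : Pt) : f.obtuse v ≤ 1 := by
  by_cases hv : v ∈ f.verts
  · obtain ⟨g, hg, rfl⟩ := exists_eq_shift_of_mem_verts hv
    rw [obtuse_shift_zero]
    have : ∀ g ∈ facesAtOrigin, g.obtuse 0 ≤ 1 := by decide +kernel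
    exact this g hg
  · rw [obtuse_eq_zero hv]
    exact zero_le_one

open Classical in
theorem outerObtuseAngles_eq (B : Finset Face) :
    outerObtuseAngles B = ∑ v ∈ verts B, if IsInner B v then 0 else obtuseCount B v := by
  have h := sum_obtuse (B := B) fun v => if IsInner B v then 0 else 1
  simp only [ite_mul, zero_mul, one_mul] at h
  rw [h, outerObtuseAngles]
  refine Finset.sum_congr rfl fun f _ => ?_
  rw [Face.verts, Finset.sum_image f.corner_injOn, Finset.card_filter]
  refine Finset.sum_congr rfl fun j hj => ?_
  simp only [Face.angle_eq_iff (Finset.mem_range.1 hj)]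
  have := f.obtuse_le_one (f.corner j)
  by_cases hin : IsInner B (f.corner j)
  · simp [hin]
  · simp only [hin, not_false_eq_true, true_and, if_false]
    split_ifs <;> omega

end TriGrid

theorem mainTheorem2 (B : Finset TriGrid.Face) (hB : TriGrid.IsTRClass B) :
    TriGrid.sigma B - (TriGrid.outerEdges B : ℚ)
      + ((TriGrid.freeValencies B : ℚ) - (TriGrid.outerEdges B : ℚ)) / 3
      + 5 / 3 * (TriGrid.specialVertices B : ℚ)
      + 5 / 3 * (TriGrid.outerObtuseAngles B : ℚ) = 0 := by
  classical
  have hsum := Finset.sum_eq_zero fun v hv => hB.local_identity (v := v) hv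
  have hq := congrArg (Int.cast : ℤ → ℚ) hsum
  have hk : ∑ v ∈ TriGrid.verts B,
      (((TriGrid.outerEdgeSet B).filter fun e => v ∈ e).card : ℚ) =
        2 * (TriGrid.outerEdges B : ℚ) := by
    exact_mod_cast TriGrid.sum_card_filter_mem (TriGrid.outerEdgeSet_subset B)
  have hτ : (TriGrid.freeValencies B : ℚ) =
      ∑ v ∈ TriGrid.verts B, (5 - (TriGrid.degree B v : ℚ)) := by
    rw [TriGrid.freeValencies]
    push_cast
    rfl
  have hb₁ : (TriGrid.specialVertices B : ℚ) =
      ∑ v ∈ TriGrid.verts B, if TriGrid.IsSpecial B v then (1 : ℚ) else 0 := by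
    rw [TriGrid.specialVertices, Finset.card_filter]
    push_cast
    rfl
  have hb₂ : (TriGrid.outerObtuseAngles B : ℚ) =
      ∑ v ∈ TriGrid.verts B, if TriGrid.IsInner B v then (0 : ℚ)
        else (TriGrid.obtuseCount B v : ℚ) := by
    rw [TriGrid.outerObtuseAngles_eq]
    push_cast
    rfl
  have hσ := TriGrid.three_mul_sigma B
  push_cast at hq
  simp only [Finset.sum_add_distrib, Finset.sum_sub_distrib, ← Finset.mul_sum] at hq hσ hτ
  linarith
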